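/- Let $c>0$, $\beta\in(0,1]$, $\sigma>0$, put $\gamma=\frac{4c}{\beta\sigma^2}$, and let $(B_s)_{s\ge 0}$ be a standard one-dimensional Brownian motion started at $0$. For $\mu\in\mathbb R$ and $T\ge 0$ let $$A^{(\mu)}_T=\int_0^T \exp\{2(\mu s+B_s)\}\,ds .$$ For $\eta\in\mathbb R$ and $\lambda,t>0$ define $$\xi_t(\lambda)=\Big[\gamma A^{(\eta)}_{\frac{\sigma^2\beta^2}{4}t}+\lambda^{-\beta}\exp\Big\{2\Big(\frac{\sigma^2\beta^2}{4}\eta t+B_{\frac{\sigma^2\beta^2}{4}t}\Big)\Big\}\Big]^{-1/\beta},\qquad \zeta_t=\Big[\gamma A^{(\eta)}_{\frac{\sigma^2\beta^2}{4}t}\Big]^{-1/\beta}.$$ Then for every $\lambda\in(0,\infty)$, $t\in(0,\infty)$ and $\eta\in\mathbb R$, all expectations below are finite and $$\mathbb E\,\xi_t(\lambda)=e^{(\frac1\beta-\eta)\frac{\beta\sigma^2}{2}t}\;\mathbb E\Big[\Big(\gamma A^{(\frac2\beta-\eta)}_{\frac{\sigma^2\beta^2}{4}t}+\lambda^{-\beta}\Big)^{-1/\beta}\Big],$$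 $$\mathbb E\,\zeta_t=e^{(\frac1\beta-\eta)\frac{\beta\sigma^2}{2}t}\;\mathbb E\Big[\Big(\gamma A^{(\frac2\beta-\eta)}_{\frac{\sigma^2\beta^2}{4}t}\Big)^{-1/\beta}\Big].$$ -/

import Mathlib

open MeasureTheory ProbabilityTheory
open scoped NNReal

noncomputable section

namespace CBBRE

variable {Ω : Type*}

/-- The exponential functional `A_T^{(η)} = ∫_0^T exp (2 (η s + B_s)) ds` of the process `B`. -/
def expFunctional (B : ℝ≥0 → Ω → ℝ) (η T : ℝ) (ω : Ω) : ℝ :=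
  ∫ s in (0 : ℝ)..T, Real.exp (2 * (η * s + B s.toNNReal ω))

/-- The constant `γ = 4 c / (β σ²)`. -/
def gam (c β σ : ℝ) : ℝ := 4 * c / (β * σ ^ 2)

/-- The changed time `σ² β² t / 4`. -/
def clock (β σ t : ℝ) : ℝ := σ ^ 2 * β ^ 2 / 4 * t

/-- The random variable
`ξ_t(lam) = [γ A_T^{(η)} + lam^{-β} exp (2 (η T + B_T))]^{-1/β}` with `T = σ² β² t / 4`. -/
def xi (B : ℝ≥0 → Ω → ℝ) (c β σ η lam t : ℝ) (ω : Ω) : ℝ :=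
  (gam c β σ * expFunctional B η (clock β σ t) ω
    + lam ^ (-β) * Real.exp (2 * (η * clock β σ t + B (clock β σ t).toNNReal ω))) ^ (-(1 / β))

/-- The random variable `ζ_t = [γ A_T^{(η)}]^{-1/β}` with `T = σ² β² t / 4`. -/
def zeta (B : ℝ≥0 → Ω → ℝ) (c β σ η t : ℝ) (ω : Ω) : ℝ :=
  (gam c β σ * expFunctional B η (clock β σ t) ω) ^ (-(1 / β))

end CBBRE

end

/-!
Write `A^η` for `expFunctional B η T`, where `T` is the value of the clock, and let `p = 1 / β`.
Both identities are instances, with `κ = lam ^ (-β)` and `κ = 0`, of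

  `E (g A^η + κ exp (2 (η T + B_T)))^(-p) = exp (2 p (p - η) T) * E (g A^(2 p - η) + κ)^(-p)`.

To prove it, reverse time: `C_u = B_{T - u} - B_T` is again a Brownian motion on `[0, T]`
(`isBrownianReal_reversal`), and substituting `s = T - u` in the integral gives
`A^η(B) = exp (2 (η T + B_T)) * A^(-η)(C)` (`expFunctional_eq_reversal`). Since `B_T = - C_T`, the
left-hand side is `exp (- 2 p η T) * E [exp (2 p C_T) * (g A^(-η)(C) + κ)^(-p)]`. By the
Cameron-Martin formula the weight `exp (2 p C_T)` turns `C` into `C` with drift `2 p`, at the price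
of the factor `exp (2 p² T)`; this changes `A^(-η)` to `A^(2 p - η)`, and `C` has the law of `B`.

The Cameron-Martin formula (`lintegral_exp_mul_cameronMartin`) reduces to one Gaussian variable:
the bridge `B_s - (s / T) B_T` is independent of `B_T`, so only the law of `B_T` is tilted.

The paths are continuous only almost surely and the process is indexed by an uncountable set, so
laws are compared through the values of the path at the countably many points of `grid T`. On
continuous paths `A^η` is the limit of Riemann sums over that grid, hence a measurable function
of these values. Finiteness of the expectations comes from `E (A^η)^(-p) < ∞`: Jensen's inequality
for the exponential bounds the moments of the Riemann sums by exponential moments of Gaussian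
variables, and Fatou's lemma passes to the limit
(`lintegral_expFunctional_rpow_neg_lt_top`).
-/

namespace CBBRE

open Filter Topology

variable {Ω : Type*}

/-! ### Exponential tilting of a Gaussian variable -/

theorem lintegral_exp_mul_gaussianReal (a : ℝ) (v : ℝ≥0) {f : ℝ → ENNReal} (hf : Measurable f) :
    ∫⁻ x, ENNReal.ofReal (Real.exp (a * x)) * f x ∂gaussianReal 0 v =
      ENNReal.ofReal (Real.exp (a ^ 2 * v / 2)) * ∫⁻ x, f (x + a * v) ∂gaussianReal 0 v := by
  by_cases hv : v = 0
  · subst hv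
    simp [lintegral_dirac' _ hf, lintegral_dirac]
  have hshift : ∫⁻ x, f (x + a * v) ∂gaussianReal 0 v = ∫⁻ x, f x ∂gaussianReal (a * v) v := by
    rw [← lintegral_map hf (by fun_prop), gaussianReal_map_add_const, zero_add]
  rw [hshift, gaussianReal_of_var_ne_zero _ hv, gaussianReal_of_var_ne_zero _ hv,
    lintegral_withDensity_eq_lintegral_mul _ (measurable_gaussianPDF _ _) (by fun_prop),
    lintegral_withDensity_eq_lintegral_mul _ (measurable_gaussianPDF _ _) hf,
    ← lintegral_const_mul _ (by fun_prop)]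
  congr 1 with x
  simp only [Pi.mul_apply, ← mul_assoc, gaussianPDF_def]
  congr 1
  rw [← ENNReal.ofReal_mul (gaussianPDFReal_nonneg _ _ _), ← ENNReal.ofReal_mul (Real.exp_nonneg _)]
  congr 1
  have hv' : (v : ℝ) ≠ 0 := by exact_mod_cast hv
  -- completing the square: `a x - x² / (2v) = a² v / 2 - (x - a v)² / (2v)`
  rw [gaussianPDFReal, gaussianPDFReal, mul_assoc, mul_left_comm (Real.exp _), ← Real.exp_add,
    ← Real.exp_add]
  congr 2
  field_simp
  ring

/-! ### Riemann sums of the exponential functional -/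

theorem tendsto_riemannSum_integral {f : ℝ → ℝ} (hf : Continuous f) {T : ℝ} (hT : 0 ≤ T) :
    Tendsto (fun n : ℕ ↦ T / (n + 1) * ∑ k : Fin (n + 1), f (k * (T / (n + 1)))) atTop
      (𝓝 (∫ s in 0..T, f s)) := by
  have huc : UniformContinuousOn f (Set.Icc 0 T) :=
    isCompact_Icc.uniformContinuousOn_of_continuous hf.continuousOn
  rw [Metric.tendsto_atTop]
  intro ε hε
  obtain ⟨δ, hδ, hfδ⟩ := Metric.uniformContinuousOn_iff.1 huc (ε / (T + 1)) (by positivity)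
  obtain ⟨N, hN⟩ := exists_nat_gt (T / δ)
  refine ⟨N, fun n hn ↦ ?_⟩
  have hn1 : (0 : ℝ) < n + 1 := by positivity
  set h : ℝ := T / (n + 1) with hh
  have hh0 : 0 ≤ h := by positivity
  have hhT : (n + 1) * h = T := by rw [hh]; field_simp
  have hhδ : h < δ := by
    have : (N : ℝ) ≤ n := by exact_mod_cast hn
    rw [hh, div_lt_iff₀ hn1, mul_comm, ← div_lt_iff₀ hδ]
    linarith
  have hsum : ∫ s in 0..T, f s =
      ∑ k ∈ Finset.range (n + 1), ∫ s in (k * h)..((k + 1 : ℕ) * h), f s := by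
    rw [intervalIntegral.sum_integral_adjacent_intervals (a := fun k : ℕ ↦ (k : ℝ) * h)
      fun k _ ↦ hf.intervalIntegrable _ _]
    push_cast
    rw [hhT, zero_mul]
  have hpiece : ∀ k ∈ Finset.range (n + 1),
      ‖h * f (k * h) - ∫ s in (k * h)..((k + 1 : ℕ) * h), f s‖ ≤ ε / (T + 1) * h := by
    intro k hk
    have hk : (k : ℝ) + 1 ≤ n + 1 := by exact_mod_cast Finset.mem_range.1 hk
    have hlen : ((k + 1 : ℕ) : ℝ) * h - k * h = h := by push_cast; ring
    have hconst : h * f (k * h) = ∫ _ in (k * h)..((k + 1 : ℕ) * h), f (k * h) := by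
      rw [intervalIntegral.integral_const, hlen, smul_eq_mul]
    rw [hconst, ← intervalIntegral.integral_sub (by simp) (hf.intervalIntegrable _ _)]
    refine (intervalIntegral.norm_integral_le_of_norm_le_const fun s hs ↦ ?_).trans_eq
      (by rw [hlen, abs_of_nonneg hh0])
    rw [Set.uIoc_of_le (by linarith)] at hs
    have hk0 : 0 ≤ (k : ℝ) * h := by positivity
    have hk1 : ((k + 1 : ℕ) : ℝ) * h ≤ T := by
      rw [← hhT]; push_cast; gcongr
    refine (hfδ _ ⟨hk0, by linarith⟩ _ ⟨by linarith [hs.1], hs.2.trans hk1⟩ ?_).le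
    rw [Real.dist_eq, abs_sub_comm, abs_of_pos (by linarith [hs.1])]
    linarith [hs.2]
  rw [Fin.sum_univ_eq_sum_range (fun k ↦ f (k * h)), Real.dist_eq, hsum, Finset.mul_sum,
    ← Finset.sum_sub_distrib]
  calc _ ≤ ∑ k ∈ Finset.range (n + 1), ε / (T + 1) * h := norm_sum_le_of_le _ hpiece
    _ = ε * (T / (T + 1)) := by
      rw [Finset.sum_const, Finset.card_range, nsmul_eq_mul]
      push_cast
      rw [mul_left_comm, hhT]
      ring
    _ < ε * 1 := by
      gcongr
      rw [div_lt_one (by positivity)]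
      linarith
    _ = ε := mul_one ε

/-- The points `k T / (n + 1)`, `k ≤ n`, of all uniform subdivisions of `[0, T]`, as one countable
family. -/
noncomputable def grid (T : ℝ≥0) (i : Σ n : ℕ, Fin (n + 1)) : ℝ≥0 := i.2 * (T / (i.1 + 1))

theorem grid_le (T : ℝ≥0) (i : Σ n : ℕ, Fin (n + 1)) : grid T i ≤ T := by
  have h : (i.2 : ℝ≥0) ≤ i.1 + 1 := by exact_mod_cast i.2.2.le
  calc grid T i ≤ (i.1 + 1) * (T / (i.1 + 1)) := by unfold grid; gcongr
    _ = T := by field_simp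

/-- The left Riemann sum over `n + 1` intervals for `∫_0^T exp (2 (μ s + x_s)) ds`, as a function
of the values `x` of the path on `grid T`. -/
noncomputable def riemannSum (T : ℝ≥0) (μ : ℝ) (x : (Σ n : ℕ, Fin (n + 1)) → ℝ) (n : ℕ) : ℝ :=
  T / (n + 1) * ∑ k : Fin (n + 1), Real.exp (2 * (μ * grid T ⟨n, k⟩ + x ⟨n, k⟩))

/-- The limit of the Riemann sums: a measurable function of the values of a path on `grid T` which
gives the exponential functional when the path is continuous. If the sums diverge, the value is
an arbitrary one. -/
noncomputable def sampledFunctional (T : ℝ≥0) (μ : ℝ) (x : (Σ n : ℕ, Fin (n + 1)) → ℝ) : ℝ :=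
  limUnder atTop (riemannSum T μ x)

theorem measurable_riemannSum (T : ℝ≥0) (μ : ℝ) (n : ℕ) :
    Measurable fun x ↦ riemannSum T μ x n := by
  unfold riemannSum
  fun_prop

theorem measurable_sampledFunctional (T : ℝ≥0) (μ : ℝ) : Measurable (sampledFunctional T μ) :=
  (StronglyMeasurable.limUnder fun n ↦ (measurable_riemannSum T μ n).stronglyMeasurable).measurable

/-- Adding the drift `a` to the path adds `a` to the drift parameter. -/
theorem sampledFunctional_add_mul_grid (T : ℝ≥0) (μ a : ℝ) (x : (Σ n : ℕ, Fin (n + 1)) → ℝ) :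
    sampledFunctional T μ (fun i ↦ x i + a * grid T i) = sampledFunctional T (μ + a) x := by
  have h : riemannSum T μ (fun i ↦ x i + a * grid T i) = riemannSum T (μ + a) x := by
    funext n
    refine congrArg (_ * ·) (Finset.sum_congr rfl fun k _ ↦ ?_)
    ring_nf
  rw [sampledFunctional, sampledFunctional, h]

section Paths

variable {B : ℝ≥0 → Ω → ℝ}

theorem tendsto_riemannSum_expFunctional (T : ℝ≥0) (μ : ℝ) {ω : Ω}
    (hω : Continuous fun s ↦ B s ω) :
    Tendsto (riemannSum T μ fun i ↦ B (grid T i) ω) atTop (𝓝 (expFunctional B μ T ω)) := by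
  have hf : Continuous fun s : ℝ ↦ Real.exp (2 * (μ * s + B s.toNNReal ω)) := by
    have : Continuous fun s : ℝ ↦ B s.toNNReal ω := hω.comp continuous_real_toNNReal
    fun_prop
  convert! tendsto_riemannSum_integral hf T.coe_nonneg using 2 with n
  refine congrArg (_ * ·) (Finset.sum_congr rfl fun k _ ↦ ?_)
  rw [show ((k : ℕ) : ℝ) * ((T : ℝ) / (n + 1)) = (grid T ⟨n, k⟩ : ℝ) by simp [grid],
    Real.toNNReal_coe]

theorem sampledFunctional_eq_expFunctional (T : ℝ≥0) (μ : ℝ) {ω : Ω}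
    (hω : Continuous fun s ↦ B s ω) :
    sampledFunctional T μ (fun i ↦ B (grid T i) ω) = expFunctional B μ T ω :=
  (tendsto_riemannSum_expFunctional T μ hω).limUnder_eq

theorem expFunctional_pos {T : ℝ} (hT : 0 < T) (μ : ℝ) {ω : Ω}
    (hω : Continuous fun s ↦ B s ω) : 0 < expFunctional B μ T ω := by
  have : Continuous fun s : ℝ ↦ B s.toNNReal ω := hω.comp continuous_real_toNNReal
  refine intervalIntegral.intervalIntegral_pos_of_pos ?_ (fun _ ↦ Real.exp_pos _) hT
  exact Continuous.intervalIntegrable (by fun_prop) _ _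

end Paths

/-- Two applications of Jensen's inequality for the exponential: the uniform average of `exp y_k` is
at least the exponential of the average of `y`, and `exp` of the average of `- p y` is at most the
average of `exp (- p y_k)`. -/
theorem riemannSum_rpow_neg_le {T : ℝ≥0} (hT : T ≠ 0) (μ : ℝ) {p : ℝ} (hp : 0 ≤ p)
    (x : (Σ n : ℕ, Fin (n + 1)) → ℝ) (n : ℕ) :
    riemannSum T μ x n ^ (-p) ≤ ∑ k : Fin (n + 1), (T : ℝ) ^ (-p) / (n + 1) *
      Real.exp (-2 * p * (μ * grid T ⟨n, k⟩ + x ⟨n, k⟩)) := by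
  have hT' : (0 : ℝ) < T := by positivity
  set y : Fin (n + 1) → ℝ := fun k ↦ 2 * (μ * grid T ⟨n, k⟩ + x ⟨n, k⟩)
  have hw : ∑ _k : Fin (n + 1), ((n : ℝ) + 1)⁻¹ = 1 := by
    rw [Finset.sum_const, Finset.card_univ, Fintype.card_fin, nsmul_eq_mul]
    push_cast
    field_simp
  have jensen (z : Fin (n + 1) → ℝ) :
      Real.exp (∑ k, ((n : ℝ) + 1)⁻¹ * z k) ≤ ∑ k, ((n : ℝ) + 1)⁻¹ * Real.exp (z k) :=
    convexOn_exp.map_sum_le (fun _ _ ↦ by positivity) hw fun _ _ ↦ Set.mem_univ _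
  calc riemannSum T μ x n ^ (-p)
      = (T * ∑ k, ((n : ℝ) + 1)⁻¹ * Real.exp (y k)) ^ (-p) := by
        rw [riemannSum, ← Finset.mul_sum, div_eq_mul_inv, mul_assoc]
    _ = (T : ℝ) ^ (-p) * (∑ k, ((n : ℝ) + 1)⁻¹ * Real.exp (y k)) ^ (-p) :=
        Real.mul_rpow hT'.le (by positivity)
    _ ≤ (T : ℝ) ^ (-p) * Real.exp (∑ k, ((n : ℝ) + 1)⁻¹ * y k) ^ (-p) := by
        gcongr ?_ * ?_
        exact Real.rpow_le_rpow_of_nonpos (Real.exp_pos _) (jensen y) (by linarith)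
    _ = (T : ℝ) ^ (-p) * Real.exp (∑ k, ((n : ℝ) + 1)⁻¹ * (-p * y k)) := by
        rw [← Real.exp_mul, Finset.sum_mul]
        congr! 3
        ring
    _ ≤ (T : ℝ) ^ (-p) * ∑ k, ((n : ℝ) + 1)⁻¹ * Real.exp (-p * y k) := by
        gcongr
        exact jensen _
    _ = _ := by
        rw [Finset.mul_sum]
        refine Finset.sum_congr rfl fun k _ ↦ ?_
        rw [← mul_assoc, ← div_eq_mul_inv]
        simp only [y]
        congr 2
        ring

/-! ### Time reversal -/

/-- The path of `B` run backwards from time `T`. For `u ≤ T` this is `B_{T - u} - B_T`; for `u > T`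
(where `T - u` truncates to `0`) the process is continued by the increments `B_u - B_T`, so that
it is a Brownian motion on the whole half-line. -/
def reversal (B : ℝ≥0 → Ω → ℝ) (T u : ℝ≥0) (ω : Ω) : ℝ :=
  B (T - u) ω + B (max u T) ω - (B T ω + B T ω)

theorem expFunctional_eq_reversal (B : ℝ≥0 → Ω → ℝ) (T : ℝ≥0) (η : ℝ) (ω : Ω) :
    expFunctional B η T ω =
      Real.exp (2 * (η * T + B T ω)) * expFunctional (reversal B T) (-η) T ω := by
  unfold expFunctional
  rw [← intervalIntegral.integral_const_mul]
  -- the substitution `s ↦ T - s`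
  have h := intervalIntegral.integral_comp_sub_left (a := 0) (b := (T : ℝ))
    (fun s ↦ Real.exp (2 * (η * s + B s.toNNReal ω))) T
  rw [sub_self, sub_zero] at h
  rw [← h]
  refine intervalIntegral.integral_congr fun s hs ↦ ?_
  rw [Set.uIcc_of_le T.coe_nonneg] at hs
  have h1 : ((T : ℝ) - s).toNNReal = T - s.toNNReal := by
    ext
    simp [NNReal.coe_sub_def, hs.1]
  have h2 : max s.toNNReal T = T := max_eq_right (Real.toNNReal_le_iff_le_coe.2 hs.2)
  simp only [← Real.exp_add, reversal, h1, h2]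
  ring_nf

variable [MeasurableSpace Ω] {P : Measure Ω} {B X Y : ℝ≥0 → Ω → ℝ}

theorem isBrownianReal_reversal (hB : IsBrownianReal B P) (T : ℝ≥0) :
    IsBrownianReal (reversal B T) P where
  toIsPreBrownianReal := by
    have hG := hB.isGaussianProcess
    have hint t := hB.integrable_eval t
    have hL (t : ℝ≥0) : MemLp (B t) 2 P := (hG.hasGaussianLaw_eval t).memLp_two
    have := hG.isProbabilityMeasure
    refine IsGaussianProcess.isPreBrownianReal_of_covariance ?_ (fun t ↦ ?_) fun s t hst ↦ ?_
    · classical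
      exact hG.of_isGaussianProcess fun u ↦ ⟨{T - u, max u T, T},
        { toFun x := x ⟨T - u, by simp⟩ + x ⟨max u T, by simp⟩ - (x ⟨T, by simp⟩ + x ⟨T, by simp⟩)
          map_add' x y := by simp; ring
          map_smul' c x := by simp; ring }, fun ω ↦ by simp [reversal]⟩
    · have h0 s : ∫ ω, B s ω ∂P = 0 := hB.integral_eval s
      have hadd (r s : ℝ≥0) : Integrable (fun ω ↦ B r ω + B s ω) P := (hint r).add (hint s)
      unfold reversal
      rw [integral_sub (hadd _ _) (hadd _ _), integral_add (hint _) (hint _),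
        integral_add (hint _) (hint _)]
      simp [h0]
    · have hadd (r s : ℝ≥0) : MemLp (B r + B s) 2 P := (hL r).add (hL s)
      have hrev (u : ℝ≥0) : reversal B T u = B (T - u) + B (max u T) - (B T + B T) := rfl
      rw [hrev, hrev, covariance_sub_left (hadd _ _) (hadd _ _) ((hadd _ _).sub (hadd _ _)),
        covariance_sub_right (hadd _ _) (hadd _ _) (hadd _ _),
        covariance_sub_right (hadd _ _) (hadd _ _) (hadd _ _)]
      simp only [covariance_add_left (hL _) (hL _) (hadd _ _),
        covariance_add_right (hL _) (hL _) (hL _), hB.covariance_eval]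
      -- the covariance is a signed sum of minima of the times `T - ·`, `max · T` and `T`
      have hs : (0 : ℝ) ≤ s := s.2
      have ht : (0 : ℝ) ≤ t := t.2
      have hT : (0 : ℝ) ≤ T := T.2
      have hst' : (s : ℝ) ≤ t := hst
      simp only [NNReal.coe_min, NNReal.coe_max, NNReal.coe_sub_def]
      rcases le_total (s : ℝ) T with h1 | h1 <;> rcases le_total (t : ℝ) T with h2 | h2 <;>
        grind
  cont := by
    filter_upwards [hB.cont] with ω h
    unfold reversal
    fun_prop

/-! ### The Cameron-Martin formula -/

/-- Both laws have the finite-dimensional marginals of the Brownian projective family. -/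
theorem map_eval_eq_of_isPreBrownianReal {ι : Type*} [Countable ι] (hX : IsPreBrownianReal X P)
    (hY : IsPreBrownianReal Y P) (τ : ι → ℝ≥0) :
    P.map (fun ω i ↦ X (τ i) ω) = P.map (fun ω i ↦ Y (τ i) ω) := by
  classical
  have := hX.isGaussianProcess.isProbabilityMeasure
  refine (map_eq_iff_forall_finset_map_restrict_eq (X := fun i ↦ X (τ i)) (Y := fun i ↦ Y (τ i))
    (aemeasurable_pi_lambda _ fun i ↦ hX.aemeasurable _)
    (aemeasurable_pi_lambda _ fun i ↦ hY.aemeasurable _)).2 fun I ↦ ?_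
  let L (x : I.image τ → ℝ) (i : I) : ℝ := x ⟨τ i, Finset.mem_image_of_mem τ i.2⟩
  have hL : Measurable L := by fun_prop
  have key {Z : ℝ≥0 → Ω → ℝ} (hZ : IsPreBrownianReal Z P) :
      P.map (fun ω ↦ I.restrict fun i ↦ Z (τ i) ω) =
        (BrownianReal.projectiveFamily (I.image τ)).map L := by
    rw [← (hZ.hasLaw (I.image τ)).map_eq,
      AEMeasurable.map_map_of_aemeasurable hL.aemeasurable (hZ.hasLaw _).aemeasurable]
    rfl
  rw [key hX, key hY]

theorem lintegral_exp_mul_eval (hB : IsPreBrownianReal B P) (a : ℝ) (s : ℝ≥0) :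
    ∫⁻ ω, ENNReal.ofReal (Real.exp (a * B s ω)) ∂P =
      ENNReal.ofReal (Real.exp (a ^ 2 * s / 2)) := by
  have h := lintegral_exp_mul_gaussianReal a s (f := fun _ ↦ 1) measurable_const
  rw [← (hB.hasLaw_eval s).map_eq, lintegral_map' (by fun_prop) (hB.aemeasurable s),
    (hB.hasLaw_eval s).map_eq] at h
  simpa using h

/-- The Cameron-Martin formula for a constant drift `a` on `[0, T]`, for functions of the values of
the path at countably many times. -/
theorem lintegral_exp_mul_cameronMartin {ι : Type*} [Countable ι] (hB : IsPreBrownianReal B P)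
    (a : ℝ) {T : ℝ≥0} (hT : T ≠ 0) {τ : ι → ℝ≥0} (hτ : ∀ i, τ i ≤ T)
    {F : (ι → ℝ) → ENNReal} (hF : Measurable F) :
    ∫⁻ ω, ENNReal.ofReal (Real.exp (a * B T ω)) * F (fun i ↦ B (τ i) ω) ∂P =
      ENNReal.ofReal (Real.exp (a ^ 2 * T / 2)) *
        ∫⁻ ω, F (fun i ↦ B (τ i) ω + a * τ i) ∂P := by
  classical
  have hG := hB.isGaussianProcess
  have := hG.isProbabilityMeasure
  have hT' : (T : ℝ) ≠ 0 := by exact_mod_cast hT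
  have hL (t : ℝ≥0) : MemLp (fun ω ↦ B t ω) 2 P := (hG.hasGaussianLaw_eval t).memLp_two
  have hm := hB.aemeasurable
  -- the Brownian bridge along `τ`, independent of `B T`
  let Z (i : ι) (ω : Ω) : ℝ := B (τ i) ω - τ i / T * B T ω
  have hZm (i : ι) : AEMeasurable (Z i) P := by fun_prop
  have hZ : AEMeasurable (fun ω i ↦ Z i ω) P := aemeasurable_pi_lambda _ hZm
  have hind : IndepFun (fun ω i ↦ Z i ω) (B T) P := by
    have h : IndepFun (fun ω i ↦ Z i ω) (fun ω (_ : Unit) ↦ B T ω) P := by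
      refine IsGaussianProcess.indepFun_of_covariance_eq_zero ?_ hZm (fun _ ↦ hm T) ?_
      · refine hG.of_isGaussianProcess ?_
        rintro (i | _)
        · exact ⟨{τ i, T},
            { toFun x := x ⟨τ i, by simp⟩ - τ i / T * x ⟨T, by simp⟩
              map_add' x y := by simp; ring
              map_smul' c x := by simp; ring }, fun ω ↦ by simp [Z]⟩
        · exact ⟨{T},
            { toFun x := x ⟨T, by simp⟩
              map_add' x y := by simp
              map_smul' c x := by simp }, fun ω ↦ by simp⟩
      · intro i _
        change cov[fun ω ↦ B (τ i) ω - τ i / T * B T ω, fun ω ↦ B T ω; P] = 0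
        rw [covariance_fun_sub_left (hL _) ((hL T).const_mul _) (hL T), covariance_const_mul_left,
          hB.covariance_fun_eval, hB.covariance_fun_eval, min_eq_left (hτ i), min_self]
        field_simp
        ring
    exact h.comp (φ := id) (ψ := fun x : Unit → ℝ ↦ x ()) measurable_id (by fun_prop)
  have hprod : P.map (fun ω ↦ ((fun i ↦ Z i ω), B T ω)) =
      (P.map fun ω i ↦ Z i ω).prod (gaussianReal 0 T) := by
    rw [(indepFun_iff_map_prod_eq_prod_map_map hZ (hm T)).1 hind, (hB.hasLaw_eval T).map_eq]
  -- the path recovered from the bridge and the endpoint; moving the endpoint by `a T` adds the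
  -- drift `a`
  let path (q : (ι → ℝ) × ℝ) (i : ι) : ℝ := q.1 i + τ i / T * q.2
  have hpath : Measurable path := by fun_prop
  have hpathB (ω : Ω) : path ((fun i ↦ Z i ω), B T ω) = fun i ↦ B (τ i) ω := by
    ext i; simp [path, Z]
  have := Measure.isProbabilityMeasure_map (μ := P) hZ
  calc ∫⁻ ω, ENNReal.ofReal (Real.exp (a * B T ω)) * F (fun i ↦ B (τ i) ω) ∂P
      = ∫⁻ q, ENNReal.ofReal (Real.exp (a * q.2)) * F (path q)
          ∂(P.map fun ω i ↦ Z i ω).prod (gaussianReal 0 T) := by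
        rw [← hprod, lintegral_map' (by fun_prop) (hZ.prodMk (hm T))]
        simp only [hpathB]
    _ = ∫⁻ z, ENNReal.ofReal (Real.exp (a ^ 2 * T / 2)) *
          ∫⁻ x, F (path (z, x + a * T)) ∂gaussianReal 0 T ∂(P.map fun ω i ↦ Z i ω) := by
        rw [lintegral_prod _ (by fun_prop)]
        congr 1 with z
        exact lintegral_exp_mul_gaussianReal a T (f := fun x ↦ F (path (z, x))) (by fun_prop)
    _ = ENNReal.ofReal (Real.exp (a ^ 2 * T / 2)) *
          ∫⁻ q, F (path (q.1, q.2 + a * T)) ∂(P.map fun ω i ↦ Z i ω).prod (gaussianReal 0 T) := by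
        rw [lintegral_prod _ (by fun_prop), lintegral_const_mul' _ _ ENNReal.ofReal_ne_top]
    _ = ENNReal.ofReal (Real.exp (a ^ 2 * T / 2)) *
          ∫⁻ ω, F (fun i ↦ B (τ i) ω + a * τ i) ∂P := by
        rw [← hprod, lintegral_map' (by fun_prop) (hZ.prodMk (hm T))]
        congr 2 with ω
        congr 1 with i
        simp only [path, Z]
        field_simp
        ring

/-! ### Negative moments of the exponential functional -/

theorem lintegral_expFunctional_rpow_neg_lt_top (hB : IsBrownianReal B P) {T : ℝ≥0}
    (hT : T ≠ 0) (μ : ℝ) {p : ℝ} (hp : 0 ≤ p) :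
    ∫⁻ ω, ENNReal.ofReal (expFunctional B μ T ω ^ (-p)) ∂P < ⊤ := by
  have hm := hB.aemeasurable
  have hT' : (0 : ℝ) < T := by positivity
  let R (n : ℕ) (ω : Ω) : ENNReal :=
    ENNReal.ofReal (riemannSum T μ (fun i ↦ B (grid T i) ω) n ^ (-p))
  have hR (n : ℕ) : AEMeasurable (R n) P := by
    have h1 : AEMeasurable (fun ω i ↦ B (grid T i) ω) P :=
      aemeasurable_pi_lambda _ fun i ↦ hm _
    exact (((measurable_riemannSum T μ n).comp_aemeasurable h1).pow_const _).ennreal_ofReal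
  -- a bound, uniform in `s ≤ T`, for `T^(-p) * E exp (-2 p (μ s + B_s))`
  let C : ℝ := (T : ℝ) ^ (-p) * Real.exp (2 * p * |μ| * T + 2 * p ^ 2 * T)
  have hterm (n : ℕ) (k : Fin (n + 1)) :
      ∫⁻ ω, ENNReal.ofReal ((T : ℝ) ^ (-p) / (n + 1) *
        Real.exp (-2 * p * (μ * grid T ⟨n, k⟩ + B (grid T ⟨n, k⟩) ω))) ∂P ≤
      ENNReal.ofReal (C / (n + 1)) := by
    set s := grid T ⟨n, k⟩
    have hs : (s : ℝ) ≤ T := grid_le T _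
    have hμ : -(μ * s) ≤ |μ| * T :=
      calc -(μ * s) ≤ |μ| * s := by nlinarith [neg_abs_le μ, s.2]
        _ ≤ |μ| * T := by gcongr
    calc _ = ∫⁻ ω, ENNReal.ofReal ((T : ℝ) ^ (-p) / (n + 1) * Real.exp (-2 * p * (μ * s))) *
          ENNReal.ofReal (Real.exp (-2 * p * B s ω)) ∂P := by
          congr 1 with ω
          rw [← ENNReal.ofReal_mul (by positivity), mul_add, Real.exp_add, mul_assoc (_ / _)]
      _ = ENNReal.ofReal ((T : ℝ) ^ (-p) / (n + 1) * Real.exp (-2 * p * (μ * s)) *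
            Real.exp ((-2 * p) ^ 2 * s / 2)) := by
          rw [lintegral_const_mul' _ _ ENNReal.ofReal_ne_top,
            lintegral_exp_mul_eval hB.toIsPreBrownianReal, ← ENNReal.ofReal_mul (by positivity)]
      _ ≤ ENNReal.ofReal (C / (n + 1)) := by
          refine ENNReal.ofReal_le_ofReal ?_
          rw [mul_assoc, ← Real.exp_add, div_mul_eq_mul_div]
          refine div_le_div_of_nonneg_right
            (mul_le_mul_of_nonneg_left (Real.exp_le_exp.2 ?_) (by positivity)) (by positivity)
          nlinarith [mul_le_mul_of_nonneg_left hμ hp,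
            mul_le_mul_of_nonneg_left hs (sq_nonneg p)]
  have hRC (n : ℕ) : ∫⁻ ω, R n ω ∂P ≤ ENNReal.ofReal C := by
    calc ∫⁻ ω, R n ω ∂P
        ≤ ∫⁻ ω, ∑ k : Fin (n + 1), ENNReal.ofReal ((T : ℝ) ^ (-p) / (n + 1) *
            Real.exp (-2 * p * (μ * grid T ⟨n, k⟩ + B (grid T ⟨n, k⟩) ω))) ∂P := by
          refine lintegral_mono fun ω ↦ ?_
          rw [← ENNReal.ofReal_sum_of_nonneg fun _ _ ↦ by positivity]
          exact ENNReal.ofReal_le_ofReal (riemannSum_rpow_neg_le hT μ hp _ n)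
      _ = ∑ k : Fin (n + 1), ∫⁻ ω, ENNReal.ofReal ((T : ℝ) ^ (-p) / (n + 1) *
            Real.exp (-2 * p * (μ * grid T ⟨n, k⟩ + B (grid T ⟨n, k⟩) ω))) ∂P :=
          lintegral_finsetSum' _ fun k _ ↦ by fun_prop
      _ ≤ ∑ _k : Fin (n + 1), ENNReal.ofReal (C / (n + 1)) := Finset.sum_le_sum fun k _ ↦ hterm n k
      _ = ENNReal.ofReal C := by
          rw [← ENNReal.ofReal_sum_of_nonneg fun _ _ ↦ by positivity, Finset.sum_const,
            Finset.card_univ, Fintype.card_fin, nsmul_eq_mul]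
          push_cast
          congr 1
          field_simp
  calc ∫⁻ ω, ENNReal.ofReal (expFunctional B μ T ω ^ (-p)) ∂P
      = ∫⁻ ω, liminf (fun n ↦ R n ω) atTop ∂P := by
        refine lintegral_congr_ae ?_
        filter_upwards [hB.cont] with ω hω
        refine (Tendsto.liminf_eq (ENNReal.tendsto_ofReal ?_)).symm
        exact (tendsto_riemannSum_expFunctional T μ hω).rpow_const
          (Or.inl (expFunctional_pos hT' μ hω).ne')
    _ ≤ liminf (fun n ↦ ∫⁻ ω, R n ω ∂P) atTop := lintegral_liminf_le' hR
    _ ≤ ENNReal.ofReal C := liminf_le_of_frequently_le' (.of_forall hRC)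
    _ < ⊤ := ENNReal.ofReal_lt_top

/-! ### The identity for expectations -/

/-- The common form of the two identities: `κ > 0` gives the one for `ξ`, `κ = 0` the one for `ζ`. -/
theorem integrable_and_integral_expFunctional_add_rpow (hB : IsBrownianReal B P) {T : ℝ≥0}
    (hT : T ≠ 0) (η : ℝ) {g κ p : ℝ} (hg : 0 < g) (hκ : 0 ≤ κ) (hp : 0 ≤ p) :
    Integrable (fun ω ↦
      (g * expFunctional B η T ω + κ * Real.exp (2 * (η * T + B T ω))) ^ (-p)) P ∧
    Integrable (fun ω ↦ (g * expFunctional B (2 * p - η) T ω + κ) ^ (-p)) P ∧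
    ∫ ω, (g * expFunctional B η T ω + κ * Real.exp (2 * (η * T + B T ω))) ^ (-p) ∂P =
      Real.exp (2 * p * (p - η) * T) *
        ∫ ω, (g * expFunctional B (2 * p - η) T ω + κ) ^ (-p) ∂P := by
  have hT' : (0 : ℝ) < T := by positivity
  have hC := isBrownianReal_reversal hB T
  set C := reversal B T with hCdef
  let Φ (μ : ℝ) (x : (Σ n : ℕ, Fin (n + 1)) → ℝ) : ℝ :=
    (g * sampledFunctional T μ x + κ) ^ (-p)
  have hΦ (μ : ℝ) : Measurable (Φ μ) :=
    (((measurable_sampledFunctional T μ).const_mul _).add_const _).pow_const _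
  have hsample {Z : ℝ≥0 → Ω → ℝ} (hZ : IsBrownianReal Z P) :
      AEMeasurable (fun ω i ↦ Z (grid T i) ω) P :=
    aemeasurable_pi_lambda _ fun i ↦ hZ.aemeasurable _
  set X : Ω → ℝ := fun ω ↦
    (g * expFunctional B η T ω + κ * Real.exp (2 * (η * T + B T ω))) ^ (-p) with hXdef
  set Y : Ω → ℝ := fun ω ↦ (g * expFunctional B (2 * p - η) T ω + κ) ^ (-p) with hYdef
  have hY : Y =ᵐ[P] fun ω ↦ Φ (2 * p - η) fun i ↦ B (grid T i) ω := by
    filter_upwards [hB.cont] with ω hω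
    simp only [Y, Φ, sampledFunctional_eq_expFunctional T _ hω]
  -- time reversal, with `exp (2 (η T + B_T))` factored out
  have hX : X =ᵐ[P] fun ω ↦ Real.exp (-2 * p * η * T) *
      (Real.exp (2 * p * C T ω) * Φ (-η) fun i ↦ C (grid T i) ω) := by
    filter_upwards [hB.eval_zero_ae_eq_zero, hC.cont] with ω h0 hω
    have hCT : C T ω = -B T ω := by simp [hCdef, reversal, h0]
    have hA := expFunctional_pos hT' (-η) hω
    simp only [X, Φ, sampledFunctional_eq_expFunctional T _ hω, expFunctional_eq_reversal B T η ω,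
      ← hCdef]
    rw [mul_left_comm, mul_comm κ, ← mul_add, Real.mul_rpow (Real.exp_nonneg _) (by positivity),
      ← Real.exp_mul, ← mul_assoc, ← Real.exp_add, hCT]
    ring_nf
  have hY0 : 0 ≤ᵐ[P] Y := by
    filter_upwards [hB.cont] with ω hω
    have := expFunctional_pos hT' (2 * p - η) hω
    simp only [Y, Pi.zero_apply]
    positivity
  have hX0 : 0 ≤ᵐ[P] X := by
    filter_upwards [hB.cont] with ω hω
    have := expFunctional_pos hT' η hω
    simp only [X, Pi.zero_apply]
    positivity
  have hYm : AEStronglyMeasurable Y P :=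
    (((hΦ _).comp_aemeasurable (hsample hB)).congr hY.symm).aestronglyMeasurable
  have hXm : AEStronglyMeasurable X P := by
    have h1 := (hΦ (-η)).comp_aemeasurable (hsample hC)
    have h2 := hC.aemeasurable T
    refine (AEMeasurable.congr ?_ hX.symm).aestronglyMeasurable
    exact ((h2.const_mul _).exp.mul h1).const_mul _
  have hYtop : ∫⁻ ω, ENNReal.ofReal (Y ω) ∂P < ⊤ := by
    calc ∫⁻ ω, ENNReal.ofReal (Y ω) ∂P
        ≤ ∫⁻ ω, ENNReal.ofReal (g ^ (-p)) *
            ENNReal.ofReal (expFunctional B (2 * p - η) T ω ^ (-p)) ∂P := by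
          refine lintegral_mono_ae ?_
          filter_upwards [hB.cont] with ω hω
          have hA := expFunctional_pos hT' (2 * p - η) hω
          rw [← ENNReal.ofReal_mul (by positivity), ← Real.mul_rpow hg.le hA.le]
          exact ENNReal.ofReal_le_ofReal
            (Real.rpow_le_rpow_of_nonpos (by positivity) (by linarith) (by linarith))
      _ < ⊤ := by
          rw [lintegral_const_mul' _ _ ENNReal.ofReal_ne_top]
          exact ENNReal.mul_lt_top ENNReal.ofReal_lt_top
            (lintegral_expFunctional_rpow_neg_lt_top hB hT _ hp)
  have hXY : ∫⁻ ω, ENNReal.ofReal (X ω) ∂P =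
      ENNReal.ofReal (Real.exp (2 * p * (p - η) * T)) * ∫⁻ ω, ENNReal.ofReal (Y ω) ∂P := by
    calc ∫⁻ ω, ENNReal.ofReal (X ω) ∂P
        = ENNReal.ofReal (Real.exp (-2 * p * η * T)) *
            ∫⁻ ω, ENNReal.ofReal (Real.exp (2 * p * C T ω)) *
              ENNReal.ofReal (Φ (-η) fun i ↦ C (grid T i) ω) ∂P := by
          rw [← lintegral_const_mul' _ _ ENNReal.ofReal_ne_top]
          refine lintegral_congr_ae ?_
          filter_upwards [hX] with ω hω
          rw [hω, ENNReal.ofReal_mul (Real.exp_nonneg _), ENNReal.ofReal_mul (Real.exp_nonneg _)]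
      -- the Cameron-Martin formula with drift `2 p`
      _ = ENNReal.ofReal (Real.exp (-2 * p * η * T)) *
            (ENNReal.ofReal (Real.exp ((2 * p) ^ 2 * T / 2)) *
              ∫⁻ ω, ENNReal.ofReal (Φ (2 * p - η) fun i ↦ C (grid T i) ω) ∂P) := by
          rw [lintegral_exp_mul_cameronMartin hC.toIsPreBrownianReal (2 * p) hT (grid_le T)
            (hΦ (-η)).ennreal_ofReal]
          simp only [Φ, sampledFunctional_add_mul_grid, neg_add_eq_sub]
      _ = ENNReal.ofReal (Real.exp (2 * p * (p - η) * T)) *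
              ∫⁻ ω, ENNReal.ofReal (Φ (2 * p - η) fun i ↦ C (grid T i) ω) ∂P := by
          rw [← mul_assoc, ← ENNReal.ofReal_mul (Real.exp_nonneg _), ← Real.exp_add]
          ring_nf
      _ = ENNReal.ofReal (Real.exp (2 * p * (p - η) * T)) *
              ∫⁻ ω, ENNReal.ofReal (Φ (2 * p - η) fun i ↦ B (grid T i) ω) ∂P := by
          -- `C` and `B` have the same law along the grid
          have hΦ' := (hΦ (2 * p - η)).ennreal_ofReal
          rw [← lintegral_map' hΦ'.aemeasurable (hsample hC),
            ← lintegral_map' hΦ'.aemeasurable (hsample hB),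
            map_eval_eq_of_isPreBrownianReal hC.toIsPreBrownianReal hB.toIsPreBrownianReal]
      _ = _ := by
          congr 1
          refine lintegral_congr_ae ?_
          filter_upwards [hY] with ω hω
          rw [hω]
  refine ⟨⟨hXm, ?_⟩, ⟨hYm, ?_⟩, ?_⟩
  · rw [hasFiniteIntegral_iff_ofReal hX0, hXY]
    exact ENNReal.mul_lt_top ENNReal.ofReal_lt_top hYtop
  · rwa [hasFiniteIntegral_iff_ofReal hY0]
  · rw [integral_eq_lintegral_of_nonneg_ae hX0 hXm, integral_eq_lintegral_of_nonneg_ae hY0 hYm,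
      hXY, ENNReal.toReal_mul, ENNReal.toReal_ofReal (Real.exp_nonneg _)]

end CBBRE

theorem mainTheorem9 {Ω : Type*} [MeasurableSpace Ω] (P : Measure Ω)
    (B : ℝ≥0 → Ω → ℝ) (hB : IsBrownianReal B P)
    (c β σ : ℝ) (hc : 0 < c) (hβ0 : 0 < β) (hβ1 : β ≤ 1) (hσ : 0 < σ)
    (lam t η : ℝ) (hlam : 0 < lam) (ht : 0 < t) :
    (Integrable (CBBRE.xi B c β σ η lam t) P ∧
      Integrable (fun ω => (CBBRE.gam c β σ *
        CBBRE.expFunctional B (2 / β - η) (CBBRE.clock β σ t) ω + lam ^ (-β)) ^ (-(1 / β))) P ∧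
      ∫ ω, CBBRE.xi B c β σ η lam t ω ∂P =
        Real.exp ((1 / β - η) * (β * σ ^ 2 / 2) * t) *
          ∫ ω, (CBBRE.gam c β σ *
            CBBRE.expFunctional B (2 / β - η) (CBBRE.clock β σ t) ω
              + lam ^ (-β)) ^ (-(1 / β)) ∂P) ∧
    (Integrable (CBBRE.zeta B c β σ η t) P ∧
      Integrable (fun ω => (CBBRE.gam c β σ *
        CBBRE.expFunctional B (2 / β - η) (CBBRE.clock β σ t) ω) ^ (-(1 / β))) P ∧
      ∫ ω, CBBRE.zeta B c β σ η t ω ∂P =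
        Real.exp ((1 / β - η) * (β * σ ^ 2 / 2) * t) *
          ∫ ω, (CBBRE.gam c β σ *
            CBBRE.expFunctional B (2 / β - η) (CBBRE.clock β σ t) ω) ^ (-(1 / β)) ∂P) := by
  have hT0 : 0 < CBBRE.clock β σ t := by unfold CBBRE.clock; positivity
  have hT : (CBBRE.clock β σ t).toNNReal ≠ 0 := (Real.toNNReal_pos.2 hT0).ne'
  have hg : 0 < CBBRE.gam c β σ := by unfold CBBRE.gam; positivity
  have hcoe : ((CBBRE.clock β σ t).toNNReal : ℝ) = CBBRE.clock β σ t := Real.coe_toNNReal _ hT0.le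
  have hexp : 2 / β * (1 / β - η) * CBBRE.clock β σ t =
      (1 / β - η) * (β * σ ^ 2 / 2) * t := by
    unfold CBBRE.clock
    field_simp
    ring
  have key {κ : ℝ} (hκ : 0 ≤ κ) := CBBRE.integrable_and_integral_expFunctional_add_rpow hB hT η
    hg hκ (one_div_nonneg.2 hβ0.le)
  simp only [hcoe, hexp, mul_one_div] at key
  refine ⟨key (Real.rpow_nonneg hlam.le (-β)), ?_⟩
  simpa only [zero_mul, add_zero] using! key le_rfl
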